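/- Let $\epsilon,\mu:\mathbb{R}^3\to\mathbb{R}$ be measurable, bounded and uniformly strictly positive, i.e. there are constants $0<c\le C$ with $c\le\epsilon(x)\le C$ and $c\le\mu(x)\le C$ for almost every $x$. For $z\in\mathbb{C}$ let $L(z)=\Delta+a(x)z^2+b(x,\partial)$ act on vector fields $u:\mathbb{R}^3\to\mathbb{C}^3$, with $$a=\epsilon\mu,\qquad b(x,\partial)u=\nabla\times\nabla\times u-\epsilon\mu\,\nabla\times\Big(\frac1\mu\,\nabla\times\frac1\epsilon u\Big).$$ Let $z\in\mathbb{C}\setminus\mathbb{R}$ and let $u\in H^2(\mathbb{R}^3;\mathbb{C}^3)$ solve $L(z)u=0$, in the sense that $\nabla\times(\frac1\epsilon u)$ and $\nabla\times(\frac1\mu\nabla\times(\frac1\epsilon u))$ exist as weak curls in $L^2_{loc}$ and the equation holds almost everywhere. Then $u=0$. -/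

import Mathlib

open MeasureTheory SchwartzMap
open scoped ContDiff Laplacian

/-- Physical space `ℝ³` with the Euclidean norm. -/
abbrev Space3 : Type := EuclideanSpace ℝ (Fin 3)

/-- The values `ℂ³` of the vector fields. -/
abbrev Vec3 : Type := EuclideanSpace ℂ (Fin 3)

/-- `u` belongs to the Sobolev space `H²(ℝ³; ℂ³)`. -/
def MemH2 (u : Space3 → Vec3) : Prop :=
  ∃ h : MemLp u 2 (volume : Measure Space3),
    TemperedDistribution.MemSobolev 2 2 ((h.toLp u : Lp Vec3 2 (volume : Measure Space3)) :
      𝓢'(Space3, Vec3))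

/-- `u ∈ L²_loc(ℝ³; ℂ³)`. -/
def MemL2loc (u : Space3 → Vec3) : Prop :=
  ∀ K : Set Space3, IsCompact K → MemLp u 2 (volume.restrict K)

/-- Real valued test functions, `φ ∈ C_c^∞(ℝ³)`. -/
def IsTestFun (φ : Space3 → ℝ) : Prop :=
  ContDiff ℝ ∞ φ ∧ HasCompactSupport φ

/-- The classical partial derivative `∂ᵢ φ (x)`. -/
noncomputable def pderiv3 (i : Fin 3) (φ : Space3 → ℝ) (x : Space3) : ℝ :=
  fderiv ℝ φ x (EuclideanSpace.single i 1)

/-- `∇ × F = G` in the weak sense, where `F` and `G` are `L²_loc` vector fields. Indices are cyclic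
in `Fin 3`, so that `(∇ × F)ᵢ = ∂_{i+1} F_{i+2} - ∂_{i+2} F_{i+1}`. -/
def HasWeakCurl (F G : Space3 → Vec3) : Prop :=
  MemL2loc F ∧ MemL2loc G ∧
    ∀ φ : Space3 → ℝ, IsTestFun φ → ∀ i : Fin 3,
      ∫ x, (pderiv3 (i + 1) φ x • F x (i + 2) - pderiv3 (i + 2) φ x • F x (i + 1)) =
        - ∫ x, φ x • G x i

/-- `Δ F = G` in the weak sense (componentwise), where `F` and `G` are `L²_loc` vector fields. -/
def HasWeakLaplacian (F G : Space3 → Vec3) : Prop :=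
  MemL2loc F ∧ MemL2loc G ∧
    ∀ φ : Space3 → ℝ, IsTestFun φ → ∫ x, (Δ φ) x • F x = ∫ x, φ x • G x

/-- `f` is a measurable, (essentially) bounded and uniformly strictly positive function. -/
def BoundedUniformlyPositive (f : Space3 → ℝ) : Prop :=
  AEMeasurable f ∧ ∃ c C : ℝ, 0 < c ∧ ∀ᵐ x, c ≤ f x ∧ f x ≤ C

/-- The graph of the operator
`b(x,∂) u = ∇ × ∇ × u - ε μ ∇ × (μ⁻¹ ∇ × (ε⁻¹ u))`:
the curls on the right exist weakly in `L²_loc` and their combination equals `w`. -/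
def MaxwellB (ε μ : Space3 → ℝ) (u w : Space3 → Vec3) : Prop :=
  ∃ C CC W V : Space3 → Vec3,
    HasWeakCurl u C ∧ HasWeakCurl C CC ∧
    HasWeakCurl (fun x => (ε x)⁻¹ • u x) W ∧ HasWeakCurl (fun x => (μ x)⁻¹ • W x) V ∧
    ∀ᵐ x, w x = CC x - (ε x * μ x) • V x

/-- `L(z) u = 0` for `L(z) = I₃ Δ + I₃ a(x) z² + b(x,∂)`, where the operator `b(x,∂)` is given
by its graph. -/
def IsNullSolution (a : Space3 → ℝ) (b : (Space3 → Vec3) → (Space3 → Vec3) → Prop) (z : ℂ)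
    (u : Space3 → Vec3) : Prop :=
  ∃ l w : Space3 → Vec3, HasWeakLaplacian u l ∧ b u w ∧
    ∀ᵐ x, l x + ((a x : ℂ) * z ^ 2) • u x + w x = 0

/-- No eigenvalues: for non-real `z`, the only `u ∈ H²` with `L(z) u = 0` is `u = 0`. -/
def NoEigenvalues (a : Space3 → ℝ) (b : (Space3 → Vec3) → (Space3 → Vec3) → Prop) : Prop :=
  ∀ z : ℂ, z.im ≠ 0 → ∀ u : Space3 → Vec3, MemH2 u → IsNullSolution a b z u → u =ᵐ[volume] 0

/-! Put `d = div u`, which lies in `L²` because `u ∈ H²`. Since `Δu + ∇×∇×u = ∇d`, the equation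
reads `V = (εμ)⁻¹∇d + z²u` with `V = ∇×(μ⁻¹∇×(ε⁻¹u))`. A curl has no divergence, so `∇·((εμ)⁻¹∇d) +
z²d = 0`. Once this forces `∇d = 0`, the field `v = ε⁻¹u` satisfies `∇×(μ⁻¹∇×v) = z²εv`, and it
remains to show `v = 0`.

Both equations have the form `D*(αDp) = z²βp`, with `D` of first order with constant real
coefficients and `p ∈ L²`, and `ae_eq_zero_of_weak_system` treats them together. Testing with `χ²p̄`
gives `∫χ²α|Dp|² + E = z²∫χ²β|p|²`, where `E` contains `∇χ`. As `z` is not real, multiplying by `z̄`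
and taking imaginary parts controls both integrals by `|E|`. Young's inequality absorbs the factor
`Dp` of `E`, which is only locally `L²`, and leaves `∫χ²|p|² ≤ M sup|∇χ|²` with `M` independent of
`χ` (`caccioppoli_bound`). Dilated cutoffs then give `p = 0`. Since `p` is not smooth, the test
function is justified by mollification in `energy_identity`. -/

/-! ### Weak convergence of mollifications. -/

section Mollification

open Filter Topology Convolution ContinuousLinearMap

variable {E : Type*} [NormedAddCommGroup E] [InnerProductSpace ℝ E] [FiniteDimensional ℝ E]
  [MeasurableSpace E] [BorelSpace E]

/-- The correlation of two square integrable functions is continuous. -/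
theorem continuous_integral_mul_translate {h f : E → ℂ} (hh : MemLp h 2 volume)
    (hf : MemLp f 2 volume) : Continuous fun t : E => ∫ x, h x * f (x + t) := by
  have : Fact ((2 : ENNReal) ≠ ⊤) := ⟨by simp⟩
  -- Translations act continuously on `L²`, and the correlation is an inner product with a translate
  -- of `f`.
  have hc : Continuous fun t : E => DomAddAct.mk t +ᵥ hf.toLp f :=
    (DomAddAct.continuous_mk).vadd continuous_const
  have hi : Continuous fun t : E =>
      inner ℂ (hh.star.toLp (star h)) (DomAddAct.mk t +ᵥ hf.toLp f) :=
    continuous_const.inner hc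
  convert hi using 2 with t
  rw [DomAddAct.mk_vadd_toLp, L2.inner_def]
  refine integral_congr_ae ?_
  filter_upwards [hh.star.coeFn_toLp, (hf.comp_measurePreserving
    (measurePreserving_vadd t (volume : Measure E))).coeFn_toLp] with x h1 h2
  rw [h1]
  refine Eq.trans ?_ (congrArg (inner ℂ (star h x)) h2.symm)
  simp [add_comm, mul_comm]

/-- Fubini for the pairing of a square integrable function with a mollified one. -/
theorem integral_mul_convolution {ρ : E → ℝ} {h f : E → ℂ} (hρ : Integrable ρ volume)
    (hh : MemLp h 2 volume) (hf : MemLp f 2 volume) :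
    ∫ x, h x * (ρ ⋆[lsmul ℝ ℝ] f) x = ∫ t, ρ t • ∫ x, h x * f (x - t) := by
  have hm : AEStronglyMeasurable (fun q : E × E => h q.1 * (ρ q.2 • f (q.1 - q.2)))
      (volume.prod volume) := by
    refine hh.1.comp_fst.mul ?_
    exact hρ.1.convolution_integrand (lsmul ℝ ℝ) hf.1
  have hI : Integrable (fun q : E × E => h q.1 * (ρ q.2 • f (q.1 - q.2)))
      (volume.prod volume) := by
    -- By `|h||f| ≤ |h|² + |f|²` the integrand is dominated by a tensor product and a convolution
    -- integrand, both integrable.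
    have i1 : Integrable (fun q : E × E => ‖h q.1‖ ^ 2 * ‖ρ q.2‖) (volume.prod volume) :=
      (hh.norm.integrable_sq).mul_prod hρ.norm
    have i2 : Integrable (fun q : E × E => ‖ρ q.2‖ * ‖f (q.1 - q.2)‖ ^ 2)
        (volume.prod volume) :=
      hρ.norm.convolution_integrand (lsmul ℝ ℝ) hf.norm.integrable_sq
    refine (i1.add i2).mono' hm (Eventually.of_forall fun q => ?_)
    simp only [norm_mul, norm_smul, Pi.add_apply]
    have := mul_nonneg (norm_nonneg (ρ q.2))
      (add_nonneg (sq_nonneg (‖h q.1‖ - ‖f (q.1 - q.2)‖))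
        (add_nonneg (sq_nonneg ‖h q.1‖) (sq_nonneg ‖f (q.1 - q.2)‖)))
    nlinarith
  have hs := integral_integral_swap (f := fun x t => h x * (ρ t • f (x - t))) hI
  calc ∫ x, h x * (ρ ⋆[lsmul ℝ ℝ] f) x = ∫ x, ∫ t, h x * (ρ t • f (x - t)) := by
        simp only [convolution_def, lsmul_apply, integral_const_mul]
    _ = ∫ t, ∫ x, h x * (ρ t • f (x - t)) := hs
    _ = _ := by
        congr 1 with t
        rw [← integral_smul]
        congr 1 with x
        rw [mul_smul_comm]

/-- Mollifications of an `L²` function converge weakly. -/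
theorem tendsto_integral_mul_mollification {φ : ℕ → ContDiffBump (0 : E)}
    (hφ : Tendsto (fun n => (φ n).rOut) atTop (𝓝 0)) {h f : E → ℂ}
    (hh : MemLp h 2 volume) (hf : MemLp f 2 volume) :
    Tendsto (fun n => ∫ x, h x * ((φ n).normed volume ⋆[lsmul ℝ ℝ] f) x) atTop
      (𝓝 (∫ x, h x * f x)) := by
  -- By Fubini the integral is the mollification at `0` of the continuous correlation `t ↦ ∫ h(x)
  -- f(x + t)`.
  have := ContDiffBump.convolution_tendsto_right_of_continuous (μ := (volume : Measure E)) hφ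
    (continuous_integral_mul_translate hh hf) 0
  simp only [add_zero] at this
  refine this.congr fun n => ?_
  rw [integral_mul_convolution (φ n).integrable_normed hh hf, convolution_def]
  simp [sub_eq_add_neg]

/-- Mollifications of an `L²_loc` function converge weakly against compactly supported
`L²` functions. -/
theorem tendsto_integral_mul_mollification_of_local {φ : ℕ → ContDiffBump (0 : E)}
    (hφ : Tendsto (fun n => (φ n).rOut) atTop (𝓝 0)) {h f : E → ℂ}
    (hh : MemLp h 2 volume) (hhc : HasCompactSupport h)
    (hf : ∀ K : Set E, IsCompact K → MemLp f 2 (volume.restrict K)) :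
    Tendsto (fun n => ∫ x, h x * ((φ n).normed volume ⋆[lsmul ℝ ℝ] f) x) atTop
      (𝓝 (∫ x, h x * f x)) := by
  obtain ⟨r, hr⟩ := hhc.isCompact.isBounded.subset_closedBall (0 : E)
  -- The margin `1` suffices: once the mollifier has radius below `1`, only the values of `f` on `K`
  -- matter on the support of `h`.
  set K := Metric.closedBall (0 : E) (r + 1)
  have hK : IsCompact K := isCompact_closedBall _ _
  have hf' : MemLp (K.indicator f) 2 volume :=
    (memLp_indicator_iff_restrict hK.measurableSet).2 (hf K hK)
  have hmem : ∀ x, h x ≠ 0 → ‖x‖ ≤ r := fun x hx => by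
    simpa using hr (subset_tsupport _ hx)
  have key := tendsto_integral_mul_mollification hφ hh hf'
  have h0 : ∫ x, h x * K.indicator f x = ∫ x, h x * f x := by
    congr 1 with x
    by_cases hx : h x = 0
    · simp [hx]
    · rw [Set.indicator_of_mem]
      simpa [K] using (hmem x hx).trans (by linarith)
  rw [h0] at key
  refine key.congr' ?_
  filter_upwards [hφ.eventually (gt_mem_nhds one_pos)] with n hn
  congr 1 with x
  by_cases hx : h x = 0
  · simp [hx]
  congr 1
  rw [convolution_def, convolution_def]
  congr 1 with t
  by_cases ht : (φ n).normed volume t = 0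
  · simp [ht]
  · have ht' : ‖t‖ < (φ n).rOut := by
      have : t ∈ Function.support ((φ n).normed volume) := ht
      rw [ContDiffBump.support_normed_eq] at this
      simpa using this
    rw [Set.indicator_of_mem]
    have := norm_sub_le x t
    simp only [K, mem_closedBall_zero_iff]
    linarith [hmem x hx]

end Mollification

/-! ### First order systems with constant coefficients. -/

section WeakSystem

open Filter Topology Convolution ContinuousLinearMap ComplexConjugate

/-- The classical partial derivative of a complex valued function. -/
noncomputable def cpderiv3 (j : Fin 3) (η : Space3 → ℂ) (x : Space3) : ℂ :=
  fderiv ℝ η x (EuclideanSpace.single j 1)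

/-- Scalar functions that are locally square integrable. -/
def ScalarL2loc (f : Space3 → ℂ) : Prop :=
  ∀ K : Set Space3, IsCompact K → MemLp f 2 (volume.restrict K)

theorem ScalarL2loc.locallyIntegrable {f : Space3 → ℂ} (hf : ScalarL2loc f) :
    LocallyIntegrable f := by
  rw [locallyIntegrable_iff]
  intro K hK
  have : IsFiniteMeasure (volume.restrict K) := ⟨by simpa using hK.measure_lt_top⟩
  exact (hf K hK).integrable (by norm_num)

theorem ScalarL2loc.conj {f : Space3 → ℂ} (hf : ScalarL2loc f) :
    ScalarL2loc fun x => conj (f x) :=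
  fun K hK => (hf K hK).star

theorem ScalarL2loc.bounded_smul {f : Space3 → ℂ} (hf : ScalarL2loc f) {a : Space3 → ℝ}
    (ha : AEMeasurable a) {C : ℝ} (hC : ∀ᵐ x, |a x| ≤ C) :
    ScalarL2loc fun x => a x • f x := fun K hK => by
  refine (hf K hK).of_le_mul (c := C) (ha.restrict.aestronglyMeasurable.smul (hf K hK).1) ?_
  filter_upwards [ae_restrict_of_ae hC] with x hx
  rw [norm_smul]
  exact mul_le_mul_of_nonneg_right hx (norm_nonneg _)

theorem ScalarL2loc.const_mul {f : Space3 → ℂ} (hf : ScalarL2loc f) (z : ℂ) :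
    ScalarL2loc fun x => z * f x :=
  fun K hK => (hf K hK).const_mul z

theorem MeasureTheory.MemLp.scalarL2loc {f : Space3 → ℂ} (hf : MemLp f 2) : ScalarL2loc f :=
  fun _ _ => hf.restrict _

theorem ScalarL2loc.memLp_smul {f : Space3 → ℂ} (hf : ScalarL2loc f) {ψ : Space3 → ℝ}
    (hψ : Continuous ψ) (hc : HasCompactSupport ψ) : MemLp (fun x => ψ x • f x) 2 := by
  obtain ⟨C, hC⟩ := hψ.bounded_above_of_compact_support hc
  have h := (hf.bounded_smul (C := C) hψ.measurable.aemeasurable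
    (Eventually.of_forall hC)) _ hc.isCompact
  rw [← memLp_indicator_iff_restrict hc.isCompact.measurableSet] at h
  refine (memLp_congr_ae (Eventually.of_forall fun x => ?_)).1 h
  by_cases hx : x ∈ tsupport ψ
  · rw [Set.indicator_of_mem hx]
  · simp only [Set.indicator_of_notMem hx, image_eq_zero_of_notMem_tsupport hx, zero_smul]

theorem IsTestFun.continuous_pderiv3 {φ : Space3 → ℝ} (hφ : IsTestFun φ) (j : Fin 3) :
    Continuous (pderiv3 j φ) :=
  (hφ.1.continuous_fderiv (by simp)).clm_apply continuous_const

theorem IsTestFun.hasCompactSupport_pderiv3 {φ : Space3 → ℝ} (hφ : IsTestFun φ) (j : Fin 3) :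
    HasCompactSupport (pderiv3 j φ) :=
  hφ.2.fderiv_apply (𝕜 := ℝ) _

theorem continuous_cpderiv3 {η : Space3 → ℂ} (hη : ContDiff ℝ ∞ η) (j : Fin 3) :
    Continuous (cpderiv3 j η) :=
  (hη.continuous_fderiv (by simp)).clm_apply continuous_const

theorem cpderiv3_mollification {ρ : Space3 → ℝ} (hρ : IsTestFun ρ) {q : Space3 → ℂ}
    (hq : LocallyIntegrable q) (j : Fin 3) (x : Space3) :
    cpderiv3 j (ρ ⋆[lsmul ℝ ℝ] q) x = ∫ t, pderiv3 j ρ (x - t) • q t := by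
  have h1 : ContDiff ℝ 1 ρ := hρ.1.of_le (by simp)
  have he : ConvolutionExistsAt (fderiv ℝ ρ) q x
      (precompL Space3 (lsmul ℝ ℝ : ℝ →L[ℝ] ℂ →L[ℝ] ℂ)) volume :=
    HasCompactSupport.convolutionExists_left _ (hρ.2.fderiv (𝕜 := ℝ))
      (h1.continuous_fderiv (by simp)) hq x
  rw [cpderiv3, (hρ.2.hasFDerivAt_convolution_left (lsmul ℝ ℝ) h1 hq x).fderiv,
    convolution_eq_swap, ContinuousLinearMap.integral_apply]
  · rfl
  · exact he.integrable_swap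

/-- Mollification commutes with first order operators with constant coefficients. -/
theorem sum_cpderiv3_mollification {κ : Type*} [Fintype κ] {c : Fin 3 → κ → ℝ}
    {ρ : Space3 → ℝ} (hρ : IsTestFun ρ) {q : κ → Space3 → ℂ} {G : Space3 → ℂ}
    (hq : ∀ k, LocallyIntegrable (q k))
    (hD : ∀ φ, IsTestFun φ →
      ∫ x, ∑ j, ∑ k, (c j k * pderiv3 j φ x) • q k x = - ∫ x, φ x • G x) (x : Space3) :
    ∑ j, ∑ k, c j k • cpderiv3 j (ρ ⋆[lsmul ℝ ℝ] q k) x = (ρ ⋆[lsmul ℝ ℝ] G) x := by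
  -- Testing with the reflected translate of `ρ` turns the weak identity into a pointwise one for
  -- convolutions at `x`.
  have hφ : IsTestFun fun t => ρ (x - t) :=
    ⟨hρ.1.comp (contDiff_const.sub contDiff_id),
      hρ.2.comp_homeomorph (Homeomorph.subLeft x)⟩
  have hd : ∀ j t, pderiv3 j (fun t => ρ (x - t)) t = - pderiv3 j ρ (x - t) := fun j t => by
    have h1 : HasFDerivAt (fun t => ρ (x - t))
        ((fderiv ℝ ρ (x - t)).comp (-ContinuousLinearMap.id ℝ Space3)) t :=
      ((hρ.1.differentiable (by simp)) (x - t)).hasFDerivAt.comp t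
        ((hasFDerivAt_id t).const_sub x)
    simp [pderiv3, h1.fderiv]
  have hInt : ∀ j k, Integrable fun t => (c j k * -pderiv3 j ρ (x - t)) • q k t := fun j k => by
    refine (hq k).integrable_smul_left_of_hasCompactSupport (g := fun t => c j k * -pderiv3 j ρ (x - t))
      (continuous_const.mul ((hρ.continuous_pderiv3 j).comp
        (continuous_const.sub continuous_id)).neg) ?_
    exact (((hρ.hasCompactSupport_pderiv3 j).comp_homeomorph
      (Homeomorph.subLeft x)).neg).mul_left
  have key := hD _ hφ
  simp only [hd] at key
  rw [integral_finsetSum _ fun j _ => integrable_finsetSum _ fun k _ => hInt j k] at key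
  simp_rw [integral_finsetSum _ fun k _ => hInt _ k] at key
  rw [convolution_eq_swap]
  simp only [lsmul_apply]
  rw [← neg_eq_iff_eq_neg] at key
  rw [← key, ← Finset.sum_neg_distrib]
  refine Finset.sum_congr rfl fun j _ => ?_
  rw [← Finset.sum_neg_distrib]
  refine Finset.sum_congr rfl fun k _ => ?_
  rw [cpderiv3_mollification hρ (hq k), ← integral_smul, ← integral_neg]
  congr 1 with t
  rw [smul_smul, mul_neg, neg_smul, neg_neg]

/-- Weak first order identities extend from real to complex test functions. -/
theorem weak_identity_complex {ι : Type*} [Fintype ι] {c : ι → Fin 3 → ℝ}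
    {F : ι → Space3 → ℂ} {H : Space3 → ℂ} (hF : ∀ i, LocallyIntegrable (F i))
    (hH : LocallyIntegrable H)
    (h : ∀ φ, IsTestFun φ →
      ∫ x, ∑ i, ∑ j, (c i j * pderiv3 j φ x) • F i x = ∫ x, φ x • H x)
    {η : Space3 → ℂ} (hη : ContDiff ℝ ∞ η) (hc : HasCompactSupport η) :
    ∫ x, ∑ i, ∑ j, (c i j • cpderiv3 j η x) * F i x = ∫ x, η x * H x := by
  have hre : IsTestFun fun x => (η x).re :=
    ⟨Complex.reCLM.contDiff.comp hη, hc.comp_left (g := Complex.re) rfl⟩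
  have him : IsTestFun fun x => (η x).im :=
    ⟨Complex.imCLM.contDiff.comp hη, hc.comp_left (g := Complex.im) rfl⟩
  have hdiff : ∀ x, DifferentiableAt ℝ η x := fun x => hη.differentiable (by simp) x
  have hd : ∀ j x, cpderiv3 j η x = (pderiv3 j (fun x => (η x).re) x : ℂ)
      + Complex.I * (pderiv3 j (fun x => (η x).im) x : ℂ) := fun j x => by
    have e1 : pderiv3 j (fun x => (η x).re) x = (cpderiv3 j η x).re := by
      have := (Complex.reCLM.hasFDerivAt.comp x (hdiff x).hasFDerivAt).fderiv
      simp only [pderiv3, cpderiv3]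
      change fderiv ℝ (Complex.reCLM ∘ η) x _ = _
      rw [this]; rfl
    have e2 : pderiv3 j (fun x => (η x).im) x = (cpderiv3 j η x).im := by
      have := (Complex.imCLM.hasFDerivAt.comp x (hdiff x).hasFDerivAt).fderiv
      simp only [pderiv3, cpderiv3]
      change fderiv ℝ (Complex.imCLM ∘ η) x _ = _
      rw [this]; rfl
    rw [e1, e2, mul_comm, Complex.re_add_im]
  have hInt : ∀ φ, IsTestFun φ →
      Integrable fun x => ∑ i, ∑ j, (c i j * pderiv3 j φ x) • F i x := fun φ hφ =>
    integrable_finsetSum _ fun i _ => integrable_finsetSum _ fun j _ =>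
      (hF i).integrable_smul_left_of_hasCompactSupport
        (g := fun x => c i j * pderiv3 j φ x)
        (continuous_const.mul (hφ.continuous_pderiv3 j)) (hφ.hasCompactSupport_pderiv3 j).mul_left
  have hInt' : ∀ φ, IsTestFun φ → Integrable fun x => φ x • H x := fun φ hφ =>
    hH.integrable_smul_left_of_hasCompactSupport hφ.1.continuous hφ.2
  calc ∫ x, ∑ i, ∑ j, (c i j • cpderiv3 j η x) * F i x
      = ∫ x, ((∑ i, ∑ j, (c i j * pderiv3 j (fun x => (η x).re) x) • F i x)
        + Complex.I * ∑ i, ∑ j, (c i j * pderiv3 j (fun x => (η x).im) x) • F i x) := by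
        congr 1 with x
        simp only [Finset.mul_sum, ← Finset.sum_add_distrib]
        refine Finset.sum_congr rfl fun i _ => Finset.sum_congr rfl fun j _ => ?_
        rw [hd]
        simp only [Complex.real_smul, Complex.ofReal_mul]
        ring
    _ = ∫ x, ((η x).re • H x + Complex.I * ((η x).im • H x)) := by
        rw [integral_add (hInt _ hre) ((hInt _ him).const_mul _), integral_const_mul,
          integral_add (hInt' _ hre) ((hInt' _ him).const_mul _), integral_const_mul,
          h _ hre, h _ him]
    _ = ∫ x, η x * H x := by
        congr 1 with x
        conv_rhs => rw [← Complex.re_add_im (η x)]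
        simp only [Complex.real_smul]
        ring

/-- Coefficients and test functions are real, so `p̄` solves the conjugate system; the energy
identity needs this since it tests with `p̄`. -/
theorem conj_weak_identity {κ : Type*} [Fintype κ] {c : Fin 3 → κ → ℝ}
    {p : κ → Space3 → ℂ} {g : Space3 → ℂ} {φ : Space3 → ℝ}
    (h : ∫ x, ∑ j, ∑ k, (c j k * pderiv3 j φ x) • p k x = - ∫ x, φ x • g x) :
    ∫ x, ∑ j, ∑ k, (c j k * pderiv3 j φ x) • conj (p k x) = - ∫ x, φ x • conj (g x) := by
  have := congrArg conj h
  rw [map_neg, ← integral_conj, ← integral_conj] at this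
  simpa [map_sum] using this

/-! ### The localized energy identity. -/

theorem IsTestFun.sq {χ : Space3 → ℝ} (hχ : IsTestFun χ) : IsTestFun fun x => χ x ^ 2 :=
  ⟨hχ.1.pow 2, hχ.2.comp_left (g := fun t : ℝ => t ^ 2) (by simp)⟩

theorem IsTestFun.pderiv3_sq {χ : Space3 → ℝ} (hχ : IsTestFun χ) (j : Fin 3) (x : Space3) :
    pderiv3 j (fun x => χ x ^ 2) x = 2 * χ x * pderiv3 j χ x := by
  have h := ((hχ.1.differentiable (by simp)) x).hasFDerivAt.pow 2
  simp only [pderiv3, h.fderiv]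
  simp

theorem IsTestFun.cpderiv3_smul {ψ : Space3 → ℝ} (hψ : IsTestFun ψ) {P : Space3 → ℂ}
    (hP : ContDiff ℝ ∞ P) (j : Fin 3) (x : Space3) :
    cpderiv3 j (fun x => ψ x • P x) x = ψ x • cpderiv3 j P x + pderiv3 j ψ x • P x := by
  have h := ((hψ.1.differentiable (by simp)) x).hasFDerivAt.smul
    ((hP.differentiable (by simp)) x).hasFDerivAt
  have h' : fderiv ℝ (fun x => ψ x • P x) x = _ := h.fderiv
  simp only [cpderiv3, pderiv3, h']
  simp

theorem ScalarL2loc.integrable_smul_mul {F : Space3 → ℂ} (hF : ScalarL2loc F)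
    {ψ : Space3 → ℝ} (hψ : Continuous ψ) (hc : HasCompactSupport ψ) {P : Space3 → ℂ}
    (hP : Continuous P) : Integrable fun x => (ψ x • F x) * P x := by
  have := hF.locallyIntegrable.integrable_smul_left_of_hasCompactSupport
    (g := fun x => ψ x • P x) (hψ.smul hP) hc.smul_right
  refine this.congr (Eventually.of_forall fun x => ?_)
  simp only [smul_eq_mul, Complex.real_smul]
  ring

/-- The localized energy identity for a weak solution `p` of `D* F = H`, with `D p = g`, where
`D` is a first order operator with constant coefficients. -/
theorem energy_identity {ι κ : Type*} [Fintype ι] [Fintype κ] {c : ι → Fin 3 → κ → ℝ}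
    {p H : κ → Space3 → ℂ} {g F : ι → Space3 → ℂ}
    (hp : ∀ k, ScalarL2loc (p k)) (hH : ∀ k, ScalarL2loc (H k))
    (hg : ∀ i, ScalarL2loc (g i)) (hF : ∀ i, ScalarL2loc (F i))
    (hD : ∀ φ, IsTestFun φ → ∀ i,
      ∫ x, ∑ j, ∑ k, (c i j k * pderiv3 j φ x) • p k x = - ∫ x, φ x • g i x)
    (hA : ∀ φ, IsTestFun φ → ∀ k,
      ∫ x, ∑ i, ∑ j, (c i j k * pderiv3 j φ x) • F i x = ∫ x, φ x • H k x)
    {χ : Space3 → ℝ} (hχ : IsTestFun χ) :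
    (∑ i, ∫ x, (χ x ^ 2 • F i x) * conj (g i x))
      + ∑ i, ∑ j, ∑ k, ∫ x, ((c i j k * (2 * χ x * pderiv3 j χ x)) • F i x) * conj (p k x)
      = ∑ k, ∫ x, (χ x ^ 2 • H k x) * conj (p k x) := by
  let φ : ℕ → ContDiffBump (0 : Space3) := fun n =>
    { rIn := 1 / (n + 2), rOut := 1 / (n + 1), rIn_pos := by positivity
      rIn_lt_rOut := one_div_lt_one_div_of_lt (by positivity) (by linarith) }
  have hφ : Tendsto (fun n => (φ n).rOut) atTop (𝓝 0) := tendsto_one_div_add_atTop_nhds_zero_nat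
  let ρ : ℕ → Space3 → ℝ := fun n => (φ n).normed volume
  have hρ : ∀ n, IsTestFun (ρ n) := fun n =>
    ⟨(φ n).contDiff_normed, (φ n).hasCompactSupport_normed⟩
  -- `χ²p̄` is not an admissible test function, so `p̄` is mollified; `D` maps the mollified `p̄` to
  -- the mollified `ḡ`.
  let Q : ℕ → κ → Space3 → ℂ := fun n k => ρ n ⋆[lsmul ℝ ℝ] fun x => conj (p k x)
  let R : ℕ → ι → Space3 → ℂ := fun n i => ρ n ⋆[lsmul ℝ ℝ] fun x => conj (g i x)
  have hQ : ∀ n k, ContDiff ℝ ∞ (Q n k) := fun n k =>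
    (hρ n).2.contDiff_convolution_left (lsmul ℝ ℝ) (hρ n).1 (hp k).conj.locallyIntegrable
  have hR : ∀ n i, Continuous (R n i) := fun n i =>
    (hρ n).2.continuous_convolution_left (lsmul ℝ ℝ) (hρ n).1.continuous
      (hg i).conj.locallyIntegrable
  have hDQ : ∀ n i x, ∑ j, ∑ k, c i j k • cpderiv3 j (Q n k) x = R n i x := fun n i x =>
    sum_cpderiv3_mollification (hρ n) (fun k => (hp k).conj.locallyIntegrable)
      (fun φ hφ => conj_weak_identity (hD φ hφ i)) x
  have hχc : Continuous fun x => χ x ^ 2 := hχ.sq.1.continuous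
  -- These weights come from `∂ⱼ(χ²) = 2χ ∂ⱼχ`.
  let ψ : ι → Fin 3 → κ → Space3 → ℝ := fun i j k x => c i j k * (2 * χ x * pderiv3 j χ x)
  have hψc : ∀ i j k, Continuous (ψ i j k) := fun i j k =>
    continuous_const.mul ((continuous_const.mul hχ.1.continuous).mul (hχ.continuous_pderiv3 j))
  have hψs : ∀ i j k, HasCompactSupport (ψ i j k) := fun i j k =>
    (HasCompactSupport.mul_left (hχ.hasCompactSupport_pderiv3 j)).mul_left
  have hid : ∀ n, (∑ i, ∫ x, (χ x ^ 2 • F i x) * R n i x)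
      + ∑ i, ∑ j, ∑ k, ∫ x, (ψ i j k x • F i x) * Q n k x
      = ∑ k, ∫ x, (χ x ^ 2 • H k x) * Q n k x := by
    intro n
    have hη : ∀ k, ContDiff ℝ ∞ fun x => χ x ^ 2 • Q n k x := fun k => hχ.sq.1.smul (hQ n k)
    have hs : ∀ k, HasCompactSupport fun x => χ x ^ 2 • Q n k x := fun k =>
      hχ.sq.2.smul_right
    have hk : ∀ k, ∫ x, (χ x ^ 2 • H k x) * Q n k x = ∫ x, ∑ i, ∑ j,
        (c i j k • cpderiv3 j (fun x => χ x ^ 2 • Q n k x) x) * F i x := fun k => by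
      rw [weak_identity_complex (fun i => (hF i).locallyIntegrable) (hH k).locallyIntegrable
        (fun φ hφ => hA φ hφ k) (hη k) (hs k)]
      congr 1 with x
      simp only [Complex.real_smul]
      ring
    have hInt : ∀ k, Integrable fun x => ∑ i, ∑ j,
        (c i j k • cpderiv3 j (fun x => χ x ^ 2 • Q n k x) x) * F i x := fun k =>
      integrable_finsetSum _ fun i _ => integrable_finsetSum _ fun j _ =>
        (hF i).locallyIntegrable.integrable_smul_left_of_hasCompactSupport
          (g := fun x => c i j k • cpderiv3 j (fun x => χ x ^ 2 • Q n k x) x)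
          ((continuous_const_smul (c i j k)).comp (continuous_cpderiv3 (hη k) j))
          (((hs k).fderiv_apply (𝕜 := ℝ) _).comp_left (g := fun w : ℂ => c i j k • w) (by simp))
    have i1 : ∀ i, Integrable fun x => (χ x ^ 2 • F i x) * R n i x := fun i =>
      (hF i).integrable_smul_mul hχc hχ.sq.2 (hR n i)
    have i2 : ∀ i j k, Integrable fun x => (ψ i j k x • F i x) * Q n k x := fun i j k =>
      (hF i).integrable_smul_mul (hψc i j k) (hψs i j k) (hQ n k).continuous
    simp_rw [hk]
    rw [← integral_finsetSum _ fun k _ => hInt k]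
    simp_rw [← integral_finsetSum _ fun k _ => i2 _ _ k]
    simp_rw [← integral_finsetSum _ fun j _ => integrable_finsetSum _ fun k _ => i2 _ j k]
    rw [← integral_finsetSum _ fun i _ => integrable_finsetSum _ fun j _ =>
      integrable_finsetSum _ fun k _ => i2 i j k, ← integral_finsetSum _ fun i _ => i1 i,
      ← integral_add (integrable_finsetSum _ fun i _ => i1 i)
        (integrable_finsetSum _ fun i _ => integrable_finsetSum _ fun j _ =>
          integrable_finsetSum _ fun k _ => i2 i j k)]
    congr 1 with x
    conv_rhs => rw [Finset.sum_comm]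
    rw [← Finset.sum_add_distrib]
    refine Finset.sum_congr rfl fun i _ => ?_
    conv_rhs => rw [Finset.sum_comm]
    rw [← hDQ, Finset.mul_sum,
      ← Finset.sum_add_distrib]
    refine Finset.sum_congr rfl fun j _ => ?_
    rw [Finset.mul_sum, ← Finset.sum_add_distrib]
    refine Finset.sum_congr rfl fun k _ => ?_
    rw [hχ.sq.cpderiv3_smul (hQ n k), hχ.pderiv3_sq]
    simp only [ψ, Complex.real_smul, Complex.ofReal_mul]
    ring
  -- Each integral is linear in its mollified factor and the other factor is fixed, compactly
  -- supported and in `L²`, so weak convergence is enough.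
  have l1 : ∀ i, Tendsto (fun n => ∫ x, (χ x ^ 2 • F i x) * R n i x) atTop
      (𝓝 (∫ x, (χ x ^ 2 • F i x) * conj (g i x))) := fun i =>
    tendsto_integral_mul_mollification_of_local hφ ((hF i).memLp_smul hχc hχ.sq.2)
      hχ.sq.2.smul_right (hg i).conj
  have l2 : ∀ i j k, Tendsto (fun n => ∫ x, (ψ i j k x • F i x) * Q n k x) atTop
      (𝓝 (∫ x, (ψ i j k x • F i x) * conj (p k x))) := fun i j k =>
    tendsto_integral_mul_mollification_of_local hφ ((hF i).memLp_smul (hψc i j k) (hψs i j k))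
      (hψs i j k).smul_right (hp k).conj
  have l3 : ∀ k, Tendsto (fun n => ∫ x, (χ x ^ 2 • H k x) * Q n k x) atTop
      (𝓝 (∫ x, (χ x ^ 2 • H k x) * conj (p k x))) := fun k =>
    tendsto_integral_mul_mollification_of_local hφ ((hH k).memLp_smul hχc hχ.sq.2)
      hχ.sq.2.smul_right (hp k).conj
  refine tendsto_nhds_unique ?_ (tendsto_finsetSum _ fun k _ => l3 k)
  refine Tendsto.congr hid ?_
  exact (tendsto_finsetSum _ fun i _ => l1 i).add
    (tendsto_finsetSum _ fun i _ => tendsto_finsetSum _ fun j _ =>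
      tendsto_finsetSum _ fun k _ => l2 i j k)

/-! ### Caccioppoli bound and vanishing of global `L²` solutions. -/

/-- After multiplication by `z̄` the right side is `z|z|²b`, and the imaginary parts of `z̄a` and
`-z|z|²b` have the same sign. Hence purely imaginary `z` needs no separate case. -/
theorem abs_im_mul_add_le {z E : ℂ} {a b : ℝ} (ha : 0 ≤ a) (hb : 0 ≤ b)
    (h : (a : ℂ) + E = z ^ 2 * b) : |z.im| * (a + ‖z‖ ^ 2 * b) ≤ ‖z‖ * ‖E‖ := by
  have hE : E = z ^ 2 * b - a := by rw [← h]; ring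
  have him : (conj z * E).im = z.im * (a + ‖z‖ ^ 2 * b) := by
    rw [hE, Complex.sq_norm, Complex.normSq_apply]
    simp [pow_two]
    ring
  calc |z.im| * (a + ‖z‖ ^ 2 * b) = |(conj z * E).im| := by
        rw [him, abs_mul, abs_of_nonneg (by positivity : 0 ≤ a + ‖z‖ ^ 2 * b)]
    _ ≤ ‖conj z * E‖ := Complex.abs_im_le_norm _
    _ = ‖z‖ * ‖E‖ := by rw [norm_mul, Complex.norm_conj]

theorem BoundedUniformlyPositive.abs_le {α : Space3 → ℝ} (hα : BoundedUniformlyPositive α) :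
    ∃ C, 0 ≤ C ∧ ∀ᵐ x, |α x| ≤ C := by
  obtain ⟨-, c, C, hc, h⟩ := hα
  refine ⟨|C|, abs_nonneg _, ?_⟩
  filter_upwards [h] with x hx
  rw [abs_of_pos (hc.trans_le hx.1)]
  exact hx.2.trans (le_abs_self _)

theorem ScalarL2loc.integrable_mul_norm_sq {f : Space3 → ℂ} (hf : ScalarL2loc f)
    {χ : Space3 → ℝ} (hχ : IsTestFun χ) {α : Space3 → ℝ} (hα : BoundedUniformlyPositive α) :
    Integrable fun x => χ x ^ 2 * (α x * ‖f x‖ ^ 2) := by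
  obtain ⟨C, hC0, hC⟩ := hα.abs_le
  have h := (hf.memLp_smul hχ.1.continuous hχ.2).norm.integrable_sq
  refine (h.bdd_mul (c := C) hα.1.aestronglyMeasurable hC).congr (Eventually.of_forall fun x => ?_)
  simp only [norm_smul, mul_pow, Real.norm_eq_abs, sq_abs]
  ring

theorem integral_smul_mul_conj (χ α : Space3 → ℝ) (f : Space3 → ℂ) :
    ∫ x, (χ x ^ 2 • (α x • f x)) * conj (f x)
      = ((∫ x, χ x ^ 2 * (α x * ‖f x‖ ^ 2) : ℝ) : ℂ) := by
  rw [← integral_complex_ofReal]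
  congr 1 with x
  have := Complex.mul_conj' (f x)
  simp only [Complex.real_smul]
  push_cast
  rw [← this]
  ring

/-- Caccioppoli type bound for weak solutions of `D* (α D p) = z² β p` with non-real `z`. -/
theorem caccioppoli_bound {ι κ : Type*} [Fintype ι] [Fintype κ] {c : ι → Fin 3 → κ → ℝ}
    {p : κ → Space3 → ℂ} {g : ι → Space3 → ℂ} {α β : Space3 → ℝ} {z : ℂ} (hz : z.im ≠ 0)
    (hα : BoundedUniformlyPositive α) (hβ : BoundedUniformlyPositive β)
    (hp : ∀ k, MemLp (p k) 2) (hg : ∀ i, ScalarL2loc (g i))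
    (hD : ∀ φ, IsTestFun φ → ∀ i,
      ∫ x, ∑ j, ∑ k, (c i j k * pderiv3 j φ x) • p k x = - ∫ x, φ x • g i x)
    (hA : ∀ φ, IsTestFun φ → ∀ k,
      ∫ x, ∑ i, ∑ j, (c i j k * pderiv3 j φ x) • (α x • g i x)
        = ∫ x, φ x • (z ^ 2 * (β x • p k x))) :
    ∃ M : ℝ, ∀ χ, IsTestFun χ → ∀ B : ℝ, (∀ j x, |pderiv3 j χ x| ≤ B) →
      ∀ k, ∫ x, χ x ^ 2 * ‖p k x‖ ^ 2 ≤ M * B ^ 2 := by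
  obtain ⟨C, hC0, hC⟩ := hα.abs_le
  obtain ⟨Cβ, -, hCβ⟩ := hβ.abs_le
  obtain ⟨a₀, _, ha₀, hαpos⟩ := hα.2
  obtain ⟨b₀, _, hb₀, hβpos⟩ := hβ.2
  have hz0 : 0 < ‖z‖ := norm_pos_iff.2 fun h => hz (by simp [h])
  have hzi : 0 < |z.im| := abs_pos.2 hz
  -- The number of pairs `(j, k)`: each `A i` is used once per pair when the error terms are summed.
  set m : ℝ := 3 * (Fintype.card κ : ℝ) with hm
  have hm0 : 0 ≤ m := by positivity
  -- The Young weight that lets the left side absorb all terms in `g`; `m + 1` keeps the denominator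
  -- positive even if `κ` is empty.
  set τ : ℝ := |z.im| / (‖z‖ * (m + 1)) with hτ
  have hτ0 : 0 < τ := by positivity
  have hτm : ‖z‖ * (τ * m) ≤ |z.im| := by
    rw [hτ, show ‖z‖ * (|z.im| / (‖z‖ * (m + 1)) * m) = |z.im| * (m / (m + 1)) by field_simp]
    exact mul_le_of_le_one_right hzi.le ((div_le_one (by positivity)).2 (by linarith))
  -- `S` involves neither `χ` nor `g`, which makes `M` uniform in the cutoff.
  set S : ℝ := ∑ i, ∑ j, ∑ k, τ⁻¹ * (c i j k ^ 2 * C) * ∫ x, ‖p k x‖ ^ 2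
  refine ⟨‖z‖ * S / (|z.im| * ‖z‖ ^ 2 * b₀), fun χ hχ B hB k₀ => ?_⟩
  have ig : ∀ i, Integrable fun x => χ x ^ 2 * (α x * ‖g i x‖ ^ 2) := fun i =>
    (hg i).integrable_mul_norm_sq hχ hα
  have ip : ∀ k, Integrable fun x => χ x ^ 2 * (β x * ‖p k x‖ ^ 2) := fun k =>
    (hp k).scalarL2loc.integrable_mul_norm_sq hχ hβ
  set A : ι → ℝ := fun i => ∫ x, χ x ^ 2 * (α x * ‖g i x‖ ^ 2)
  set D : κ → ℝ := fun k => ∫ x, χ x ^ 2 * (β x * ‖p k x‖ ^ 2)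
  have hA0 : ∀ i, 0 ≤ A i := fun i => integral_nonneg_of_ae <| by
    filter_upwards [hαpos] with x hx
    have := ha₀.le.trans hx.1
    simp only [Pi.zero_apply]; positivity
  have hD0 : ∀ k, 0 ≤ D k := fun k => integral_nonneg_of_ae <| by
    filter_upwards [hβpos] with x hx
    have := hb₀.le.trans hx.1
    simp only [Pi.zero_apply]; positivity
  have he := energy_identity (fun k => (hp k).scalarL2loc)
    (fun k => ((hp k).scalarL2loc.bounded_smul hβ.1 hCβ).const_mul (z ^ 2)) hg
    (fun i => (hg i).bounded_smul hα.1 hC) hD hA hχ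
  have hH : ∀ k, ∫ x, (χ x ^ 2 • (z ^ 2 * (β x • p k x))) * conj (p k x)
      = z ^ 2 * (D k : ℂ) := fun k => by
    rw [← integral_smul_mul_conj, ← integral_const_mul]
    congr 1 with x
    simp only [Complex.real_smul]
    ring
  simp_rw [integral_smul_mul_conj, hH] at he
  rw [← Finset.mul_sum, ← Complex.ofReal_sum, ← Complex.ofReal_sum] at he
  have hle := abs_im_mul_add_le (Finset.sum_nonneg fun i _ => hA0 i)
    (Finset.sum_nonneg fun k _ => hD0 k) he
  have hterm : ∀ i j k,
      ‖∫ x, ((c i j k * (2 * χ x * pderiv3 j χ x)) • (α x • g i x)) * conj (p k x)‖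
        ≤ τ * A i + B ^ 2 * (τ⁻¹ * (c i j k ^ 2 * C) * ∫ x, ‖p k x‖ ^ 2) := fun i j k => by
    have hsum : τ * A i + B ^ 2 * (τ⁻¹ * (c i j k ^ 2 * C) * ∫ x, ‖p k x‖ ^ 2)
        = ∫ x, (τ * (χ x ^ 2 * (α x * ‖g i x‖ ^ 2))
          + (B ^ 2 * (τ⁻¹ * (c i j k ^ 2 * C))) * ‖p k x‖ ^ 2) := by
      rw [integral_add ((ig i).const_mul _) ((hp k).norm.integrable_sq.const_mul _),
        integral_const_mul, integral_const_mul, mul_assoc (B ^ 2)]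
    rw [hsum]
    refine norm_integral_le_of_norm_le
      (((ig i).const_mul _).add ((hp k).norm.integrable_sq.const_mul _)) ?_
    filter_upwards [hC, hαpos] with x hx hx'
    have hα0 : 0 ≤ α x := ha₀.le.trans hx'.1
    rw [abs_of_nonneg hα0] at hx
    simp only [norm_mul, norm_smul, Complex.norm_conj, Real.norm_eq_abs, abs_of_nonneg hα0,
      Nat.abs_ofNat]
    set X := |χ x| * ‖g i x‖
    set Y := |c i j k| * |pderiv3 j χ x| * ‖p k x‖
    have hXY : 2 * X * Y ≤ τ * X ^ 2 + τ⁻¹ * Y ^ 2 := by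
      have : 0 ≤ τ⁻¹ * (τ * X - Y) ^ 2 := by positivity
      have e : τ⁻¹ * (τ * X - Y) ^ 2 = τ * X ^ 2 - 2 * X * Y + τ⁻¹ * Y ^ 2 := by
        field_simp
        ring
      linarith
    have hY : Y ^ 2 * α x ≤ c i j k ^ 2 * B ^ 2 * ‖p k x‖ ^ 2 * C := by
      have h1 : |pderiv3 j χ x| ^ 2 ≤ B ^ 2 := by
        gcongr; exact hB j x
      simp only [Y, mul_pow, sq_abs] at h1 ⊢
      gcongr
    have hX : X ^ 2 = χ x ^ 2 * ‖g i x‖ ^ 2 := by simp only [X, mul_pow, sq_abs]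
    calc |c i j k| * (2 * |χ x| * |pderiv3 j χ x|) * (α x * ‖g i x‖) * ‖p k x‖
        = (2 * X * Y) * α x := by simp only [X, Y]; ring
      _ ≤ (τ * X ^ 2 + τ⁻¹ * Y ^ 2) * α x := by gcongr
      _ = τ * (χ x ^ 2 * (α x * ‖g i x‖ ^ 2)) + τ⁻¹ * (Y ^ 2 * α x) := by rw [hX]; ring
      _ ≤ τ * (χ x ^ 2 * (α x * ‖g i x‖ ^ 2))
          + τ⁻¹ * (c i j k ^ 2 * B ^ 2 * ‖p k x‖ ^ 2 * C) := by gcongr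
      _ = _ := by ring
  have hE : ‖∑ i, ∑ j, ∑ k,
      ∫ x, ((c i j k * (2 * χ x * pderiv3 j χ x)) • (α x • g i x)) * conj (p k x)‖
      ≤ τ * m * ∑ i, A i + B ^ 2 * S := by
    refine (norm_sum_le_of_le _ fun i _ => norm_sum_le_of_le _ fun j _ =>
      norm_sum_le_of_le _ fun k _ => hterm i j k).trans_eq ?_
    simp only [Finset.sum_add_distrib, Finset.mul_sum, S, Finset.sum_const, Finset.card_univ,
      Fintype.card_fin, nsmul_eq_mul, hm]
    congr 1
    refine Finset.sum_congr rfl fun i _ => ?_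
    push_cast
    ring
  have hDk : b₀ * ∫ x, χ x ^ 2 * ‖p k₀ x‖ ^ 2 ≤ ∑ k, D k := by
    refine le_trans ?_ (Finset.single_le_sum (fun k _ => hD0 k) (Finset.mem_univ k₀))
    rw [← integral_const_mul]
    refine integral_mono_of_nonneg (Eventually.of_forall fun x => by positivity) (ip k₀) ?_
    filter_upwards [hβpos] with x hx
    calc b₀ * (χ x ^ 2 * ‖p k₀ x‖ ^ 2) ≤ β x * (χ x ^ 2 * ‖p k₀ x‖ ^ 2) := by
          gcongr; exact hx.1
      _ = _ := by ring
  have hA0' : 0 ≤ ∑ i, A i := Finset.sum_nonneg fun i _ => hA0 i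
  have h1 : |z.im| * ‖z‖ ^ 2 * ∑ k, D k ≤ ‖z‖ * (B ^ 2 * S) := by
    -- By the choice of `τ`, the terms `A i` on the right are absorbed by those on the left.
    have h2 := hle.trans (mul_le_mul_of_nonneg_left hE hz0.le)
    have h3 := mul_le_mul_of_nonneg_right hτm hA0'
    nlinarith
  have h4 := mul_le_mul_of_nonneg_left hDk (by positivity : 0 ≤ |z.im| * ‖z‖ ^ 2)
  rw [div_mul_eq_mul_div, le_div_iff₀ (by positivity)]
  nlinarith

/-- Cutoff functions that exhaust the space with gradients tending to zero. -/
theorem exists_cutoff : ∃ (χ : ℕ → Space3 → ℝ) (B : ℝ), (∀ n, IsTestFun (χ n)) ∧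
    (∀ n x, |χ n x| ≤ 1) ∧ (∀ x, ∀ᶠ n in atTop, χ n x = 1) ∧
    ∀ n j x, |pderiv3 j (χ n) x| ≤ B / (n + 1) := by
  -- One fixed bump is dilated by `n + 1`; the chain rule yields the decay of the gradient.
  let θ : ContDiffBump (0 : Space3) := ⟨1, 2, one_pos, one_lt_two⟩
  have hθ : IsTestFun θ := ⟨θ.contDiff, θ.hasCompactSupport⟩
  have hb : ∀ j, ∃ C, ∀ x, ‖pderiv3 j θ x‖ ≤ C := fun j =>
    (hθ.continuous_pderiv3 j).bounded_above_of_compact_support (hθ.hasCompactSupport_pderiv3 j)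
  choose C hC using hb
  have hpos : ∀ n : ℕ, (0 : ℝ) < n + 1 := fun n => by positivity
  refine ⟨fun n x => θ ((n + 1 : ℝ)⁻¹ • x), ∑ j, |C j|, fun n => ⟨?_, ?_⟩, fun n x => ?_,
    fun x => ?_, fun n j x => ?_⟩
  · exact hθ.1.comp (contDiff_const_smul _)
  · exact hθ.2.comp_smul (inv_ne_zero (hpos n).ne')
  · rw [abs_of_nonneg θ.nonneg]
    exact θ.le_one
  · obtain ⟨N, hN⟩ := exists_nat_ge ‖x‖
    filter_upwards [eventually_ge_atTop N] with n hn
    apply θ.one_of_mem_closedBall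
    have : (N : ℝ) ≤ n := by exact_mod_cast hn
    rw [mem_closedBall_zero_iff, norm_smul, norm_inv, Real.norm_of_nonneg (hpos n).le,
      inv_mul_le_iff₀ (hpos n)]
    change ‖x‖ ≤ (n + 1) * 1
    linarith
  · have h : HasFDerivAt (fun x => θ ((n + 1 : ℝ)⁻¹ • x))
        ((fderiv ℝ θ ((n + 1 : ℝ)⁻¹ • x)).comp ((n + 1 : ℝ)⁻¹ • ContinuousLinearMap.id ℝ Space3)) x :=
      ((hθ.1.differentiable (by simp)) _).hasFDerivAt.comp x
        ((n + 1 : ℝ)⁻¹ • ContinuousLinearMap.id ℝ Space3).hasFDerivAt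
    have e : pderiv3 j (fun x => θ ((n + 1 : ℝ)⁻¹ • x)) x
        = (n + 1 : ℝ)⁻¹ * pderiv3 j θ ((n + 1 : ℝ)⁻¹ • x) := by
      simp [pderiv3, h.fderiv]
    rw [e, abs_mul, abs_of_pos (inv_pos.2 (hpos n)), div_eq_inv_mul]
    refine mul_le_mul_of_nonneg_left ?_ (inv_pos.2 (hpos n)).le
    exact ((hC j _).trans (le_abs_self _)).trans
      (Finset.single_le_sum (f := fun j => |C j|) (fun j _ => abs_nonneg _) (Finset.mem_univ j))

/-- Square integrable weak solutions of `D* (α D p) = z² β p` with non-real `z` vanish. -/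
theorem ae_eq_zero_of_weak_system {ι κ : Type*} [Fintype ι] [Fintype κ]
    {c : ι → Fin 3 → κ → ℝ}
    {p : κ → Space3 → ℂ} {g : ι → Space3 → ℂ} {α β : Space3 → ℝ} {z : ℂ} (hz : z.im ≠ 0)
    (hα : BoundedUniformlyPositive α) (hβ : BoundedUniformlyPositive β)
    (hp : ∀ k, MemLp (p k) 2) (hg : ∀ i, ScalarL2loc (g i))
    (hD : ∀ φ, IsTestFun φ → ∀ i,
      ∫ x, ∑ j, ∑ k, (c i j k * pderiv3 j φ x) • p k x = - ∫ x, φ x • g i x)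
    (hA : ∀ φ, IsTestFun φ → ∀ k,
      ∫ x, ∑ i, ∑ j, (c i j k * pderiv3 j φ x) • (α x • g i x)
        = ∫ x, φ x • (z ^ 2 * (β x • p k x))) (k : κ) :
    ∀ᵐ x, p k x = 0 := by
  obtain ⟨M, hM⟩ := caccioppoli_bound hz hα hβ hp hg hD hA
  obtain ⟨χ, B, hχ, hχ1, hχe, hχB⟩ := exists_cutoff
  have hsq : Integrable fun x => ‖p k x‖ ^ 2 := (hp k).norm.integrable_sq
  have hlim : Tendsto (fun n => ∫ x, χ n x ^ 2 * ‖p k x‖ ^ 2) atTop (𝓝 (∫ x, ‖p k x‖ ^ 2)) := by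
    refine tendsto_integral_of_dominated_convergence (fun x => ‖p k x‖ ^ 2) (fun n => ?_) hsq
      (fun n => Eventually.of_forall fun x => ?_) (Eventually.of_forall fun x => ?_)
    · exact ((hχ n).1.continuous.pow 2).aestronglyMeasurable.mul hsq.1
    · rw [norm_mul, norm_pow, norm_pow, norm_norm, Real.norm_eq_abs]
      exact mul_le_of_le_one_left (by positivity) (pow_le_one₀ (abs_nonneg _) (hχ1 n x))
    · refine tendsto_const_nhds.congr' ?_
      filter_upwards [hχe x] with n hn
      rw [hn]; ring
  have hB : Tendsto (fun n : ℕ => M * (B / (n + 1)) ^ 2) atTop (𝓝 0) := by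
    have h1 : Tendsto (fun n : ℕ => B / ((n : ℝ) + 1)) atTop (𝓝 0) := by
      simpa [div_eq_mul_inv] using
        (tendsto_one_div_add_atTop_nhds_zero_nat (𝕜 := ℝ)).const_mul B
    simpa using (h1.pow 2).const_mul M
  have h0 : ∫ x, ‖p k x‖ ^ 2 ≤ 0 :=
    le_of_tendsto_of_tendsto' hlim hB fun n => hM _ (hχ n) _ (hχB n) k
  have h1 := (integral_eq_zero_iff_of_nonneg (fun x => by positivity) hsq).1
    (le_antisymm h0 (integral_nonneg fun x => by positivity))
  filter_upwards [h1] with x hx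
  simpa using hx

end WeakSystem

/-! ### Weak divergence, curl and Laplacian. -/

section Maxwell

open Filter Topology LineDeriv

theorem IsTestFun.pderiv3 {φ : Space3 → ℝ} (hφ : IsTestFun φ) (j : Fin 3) :
    IsTestFun (pderiv3 j φ) :=
  ⟨(hφ.1.fderiv_right (m := ∞) (by simp)).clm_apply contDiff_const,
    hφ.hasCompactSupport_pderiv3 j⟩

theorem IsTestFun.pderiv3_pderiv3 {φ : Space3 → ℝ} (hφ : IsTestFun φ) (i j : Fin 3)
    (x : Space3) : _root_.pderiv3 i (_root_.pderiv3 j φ) x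
      = fderiv ℝ (fderiv ℝ φ) x (EuclideanSpace.single i 1) (EuclideanSpace.single j 1) := by
  have h : DifferentiableAt ℝ (fderiv ℝ φ) x :=
    (hφ.1.fderiv_right (m := ∞) (by simp)).differentiable (by simp) x
  have h' := h.hasFDerivAt.clm_apply
    (hasFDerivAt_const (EuclideanSpace.single j 1 : Space3) x)
  have e : fderiv ℝ (_root_.pderiv3 j φ) x = _ := h'.fderiv
  rw [_root_.pderiv3, e]
  simp

theorem IsTestFun.pderiv3_comm {φ : Space3 → ℝ} (hφ : IsTestFun φ) (i j : Fin 3)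
    (x : Space3) : _root_.pderiv3 i (_root_.pderiv3 j φ) x
      = _root_.pderiv3 j (_root_.pderiv3 i φ) x := by
  rw [hφ.pderiv3_pderiv3, hφ.pderiv3_pderiv3]
  exact (hφ.1.contDiffAt.isSymmSndFDerivAt (by
    simpa using (WithTop.coe_le_coe.2 le_top : ((2 : ℕ∞) : WithTop ℕ∞) ≤ ∞))) _ _

theorem IsTestFun.laplacian_eq {φ : Space3 → ℝ} (hφ : IsTestFun φ) (x : Space3) :
    (Δ φ) x = ∑ i, _root_.pderiv3 i (_root_.pderiv3 i φ) x := by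
  rw [InnerProductSpace.laplacian_eq_iteratedFDeriv_orthonormalBasis φ
    (EuclideanSpace.basisFun (Fin 3) ℝ)]
  simp [iteratedFDeriv_two_apply, hφ.pderiv3_pderiv3]

theorem MemL2loc.component {F : Space3 → Vec3} (hF : MemL2loc F) (i : Fin 3) :
    ScalarL2loc fun x => F x i := fun K hK =>
  (EuclideanSpace.proj (𝕜 := ℂ) i).comp_memLp' (hF K hK)

theorem ScalarL2loc.add {f g : Space3 → ℂ} (hf : ScalarL2loc f) (hg : ScalarL2loc g) :
    ScalarL2loc fun x => f x + g x :=
  fun K hK => (hf K hK).add (hg K hK)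

theorem ScalarL2loc.integrable_testFun_smul {f : Space3 → ℂ} (hf : ScalarL2loc f)
    {φ : Space3 → ℝ} (hφ : IsTestFun φ) : Integrable fun x => φ x • f x :=
  hf.locallyIntegrable.integrable_smul_left_of_hasCompactSupport hφ.1.continuous hφ.2

theorem integral_smul_apply {f : Space3 → Vec3} {ψ : Space3 → ℝ}
    (h : Integrable fun x => ψ x • f x) (i : Fin 3) :
    (∫ x, ψ x • f x) i = ∫ x, ψ x • f x i := by
  have := (EuclideanSpace.proj (𝕜 := ℂ) i).integral_comp_comm h
  simpa using this.symm

theorem MemL2loc.integrable_smul {f : Space3 → Vec3} (hf : MemL2loc f) {ψ : Space3 → ℝ}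
    (hψ : Continuous ψ) (hc : HasCompactSupport ψ) : Integrable fun x => ψ x • f x := by
  have hl : LocallyIntegrable f := by
    rw [locallyIntegrable_iff]
    intro K hK
    have : IsFiniteMeasure (volume.restrict K) := ⟨by simpa using hK.measure_lt_top⟩
    exact (hf K hK).integrable (by norm_num)
  exact hl.integrable_smul_left_of_hasCompactSupport hψ hc

theorem MeasureTheory.MemLp.memL2loc {f : Space3 → Vec3} (hf : MemLp f 2) : MemL2loc f :=
  fun _ _ => hf.restrict _

/-- Functions in `H²` have weak partial derivatives in `L²`. -/
theorem MemH2.exists_weak_pderiv {u : Space3 → Vec3} (hu : MemH2 u) (i : Fin 3) :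
    ∃ w : Space3 → Vec3, MemLp w 2 ∧ ∀ φ, IsTestFun φ →
      ∫ x, pderiv3 i φ x • u x = - ∫ x, φ x • w x := by
  obtain ⟨h, hs⟩ := hu
  -- One derivative suffices: `H²` is weakened to `H¹`, whose derivatives lie in `H⁰ = L²`.
  have h1 := (hs.mono (s' := 1) (by norm_num)).lineDerivOp (m := EuclideanSpace.single i 1)
  rw [sub_self, TemperedDistribution.memSobolev_zero_iff] at h1
  obtain ⟨w, hw⟩ := h1
  refine ⟨w, Lp.memLp w, fun φ hφ => ?_⟩
  have hc : HasCompactSupport fun x => (φ x : ℂ) :=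
    hφ.2.comp_left (g := fun t : ℝ => (t : ℂ)) (by simp)
  have hd : ContDiff ℝ ∞ fun x => (φ x : ℂ) := Complex.ofRealCLM.contDiff.comp hφ.1
  have key := congrArg (fun T : 𝓢'(Space3, Vec3) => T (hc.toSchwartzMap hd)) hw
  simp only [TemperedDistribution.lineDerivOp_apply_apply, map_neg,
    Lp.toTemperedDistribution_apply] at key
  rw [eq_neg_iff_add_eq_zero, ← neg_eq_iff_add_eq_zero]
  have e1 : ∫ x, pderiv3 i φ x • u x
      = ∫ x, (∂_{(EuclideanSpace.single i 1 : Space3)} (hc.toSchwartzMap hd)) x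
        • (h.toLp u : Lp Vec3 2 (volume : Measure Space3)) x := by
    refine integral_congr_ae ?_
    filter_upwards [h.coeFn_toLp] with x hx
    rw [hx, SchwartzMap.lineDerivOp_apply_eq_fderiv]
    have hf : fderiv ℝ (fun x => (φ x : ℂ)) x = _ :=
      (Complex.ofRealCLM.hasFDerivAt.comp x
        ((hφ.1.differentiable (by simp)) x).hasFDerivAt).fderiv
    have e2 : fderiv ℝ (hc.toSchwartzMap hd) x (EuclideanSpace.single i 1)
        = (pderiv3 i φ x : ℂ) := by
      change fderiv ℝ (fun x => (φ x : ℂ)) x (EuclideanSpace.single i 1) = _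
      rw [hf]; rfl
    rw [e2]
    exact (Complex.coe_smul (pderiv3 i φ x) (u x)).symm
  rw [e1, key]
  congr 1 with x

/-- Functions in `H²` have a weak divergence in `L²`. -/
theorem MemH2.exists_weak_div {u : Space3 → Vec3} (hu : MemH2 u) :
    ∃ d : Space3 → ℂ, MemLp d 2 ∧ ∀ φ, IsTestFun φ →
      ∑ i, ∫ x, pderiv3 i φ x • u x i = - ∫ x, φ x • d x := by
  choose w hw hwφ using hu.exists_weak_pderiv
  have hwi : ∀ i, MemLp (fun x => w i x i) 2 := fun i =>
    (EuclideanSpace.proj (𝕜 := ℂ) i).comp_memLp' (hw i)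
  refine ⟨fun x => ∑ i, w i x i, memLp_finsetSum _ fun i _ => hwi i, fun φ hφ => ?_⟩
  simp_rw [Finset.smul_sum]
  rw [integral_finsetSum _ fun i _ => (hwi i).scalarL2loc.integrable_testFun_smul hφ,
    ← Finset.sum_neg_distrib]
  refine Finset.sum_congr rfl fun i _ => ?_
  have := congrArg (fun v : Vec3 => v i) (hwφ i φ hφ)
  simp only [PiLp.neg_apply] at this
  rwa [integral_smul_apply ((hw i).memL2loc.integrable_smul hφ.1.continuous hφ.2),
    integral_smul_apply (hu.1.memL2loc.integrable_smul (hφ.continuous_pderiv3 i)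
      (hφ.hasCompactSupport_pderiv3 i))] at this

/-- Iterating this form moves all derivatives onto `φ`, so identities between repeated curls reduce
to symmetry of the derivatives of `φ`. -/
theorem HasWeakCurl.integral_eq {F G : Space3 → Vec3} (h : HasWeakCurl F G) {φ : Space3 → ℝ}
    (hφ : IsTestFun φ) (i : Fin 3) :
    ∫ x, φ x • G x i = (∫ x, pderiv3 (i + 2) φ x • F x (i + 1))
      - ∫ x, pderiv3 (i + 1) φ x • F x (i + 2) := by
  have := h.2.2 φ hφ i
  rw [integral_sub ((h.1.component _).integrable_testFun_smul (hφ.pderiv3 _))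
    ((h.1.component _).integrable_testFun_smul (hφ.pderiv3 _))] at this
  rw [← neg_eq_iff_eq_neg] at this
  rw [← this]
  ring

/-- A weak curl is weakly divergence free. -/
theorem HasWeakCurl.div_eq_zero {F G : Space3 → Vec3} (h : HasWeakCurl F G) {φ : Space3 → ℝ}
    (hφ : IsTestFun φ) : ∑ i, ∫ x, pderiv3 i φ x • G x i = 0 := by
  have hc : ∀ i j : Fin 3, pderiv3 i (pderiv3 j φ) = pderiv3 j (pderiv3 i φ) := fun i j =>
    funext (hφ.pderiv3_comm i j)
  simp only [h.integral_eq (hφ.pderiv3 _), Fin.sum_univ_three, Fin.isValue, Fin.reduceAdd]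
  rw [hc 2 0, hc 1 0, hc 2 1]
  ring

/-- The weak form of `Δ u + ∇ × ∇ × u = ∇ (∇ · u)`. -/
theorem weak_grad_div {u l C CC : Space3 → Vec3} {d : Space3 → ℂ}
    (hd : ∀ φ, IsTestFun φ → ∑ i, ∫ x, pderiv3 i φ x • u x i = - ∫ x, φ x • d x)
    (hl : HasWeakLaplacian u l) (hC : HasWeakCurl u C) (hCC : HasWeakCurl C CC)
    {φ : Space3 → ℝ} (hφ : IsTestFun φ) (j : Fin 3) :
    ∫ x, pderiv3 j φ x • d x = - ∫ x, φ x • (l x j + CC x j) := by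
  have hc : ∀ i j : Fin 3, pderiv3 i (pderiv3 j φ) = pderiv3 j (pderiv3 i φ) := fun i j =>
    funext (hφ.pderiv3_comm i j)
  have hΔ : (Δ φ) = fun x => ∑ i, pderiv3 i (pderiv3 i φ) x := funext hφ.laplacian_eq
  have hlap : ∫ x, φ x • l x j = ∑ i, ∫ x, pderiv3 i (pderiv3 i φ) x • u x j := by
    have h1 := congrArg (fun v : Vec3 => v j) (hl.2.2 φ hφ)
    simp only [hΔ] at h1
    have hcont : Continuous fun x => ∑ i, pderiv3 i (pderiv3 i φ) x :=
      continuous_finsetSum _ fun i _ => (hφ.pderiv3 i).continuous_pderiv3 i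
    have hsupp : HasCompactSupport fun x => ∑ i, pderiv3 i (pderiv3 i φ) x := by
      simp only [Fin.sum_univ_three]
      exact (((hφ.pderiv3 0).pderiv3 0).2.add ((hφ.pderiv3 1).pderiv3 1).2).add
        ((hφ.pderiv3 2).pderiv3 2).2
    rw [integral_smul_apply (hl.2.1.integrable_smul hφ.1.continuous hφ.2),
      integral_smul_apply (hl.1.integrable_smul hcont hsupp)] at h1
    rw [← h1, ← integral_finsetSum _ fun i _ =>
      (hl.1.component j).integrable_testFun_smul ((hφ.pderiv3 i).pderiv3 i)]
    simp_rw [Finset.sum_smul]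
  simp_rw [smul_add]
  rw [integral_add ((hl.2.1.component j).integrable_testFun_smul hφ)
    ((hCC.2.1.component j).integrable_testFun_smul hφ), hlap, hCC.integral_eq hφ,
    hC.integral_eq (hφ.pderiv3 _), hC.integral_eq (hφ.pderiv3 _),
    ← neg_eq_iff_eq_neg.2 (hd _ (hφ.pderiv3 j))]
  -- Only second derivatives of `φ` paired with components of `u` are left; they match once mixed
  -- partials are commuted.
  fin_cases j <;>
  simp only [Fin.sum_univ_three, Fin.isValue, Fin.reduceAdd, Fin.zero_eta, Fin.mk_one,
    Fin.reduceFinMk, zero_add] <;>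
  simp only [hc 2 0, hc 1 0, hc 2 1] <;>
  ring

/-! ### The divergence equation and the curl-curl equation. -/

theorem BoundedUniformlyPositive.inv {f : Space3 → ℝ} (hf : BoundedUniformlyPositive f) :
    BoundedUniformlyPositive fun x => (f x)⁻¹ := by
  obtain ⟨hm, c, C, hc, h⟩ := hf
  -- The maximum makes the lower constant positive without deducing `c ≤ C` from the a.e. bounds.
  refine ⟨hm.inv, (max C c)⁻¹, c⁻¹, by positivity, ?_⟩
  filter_upwards [h] with x hx
  have := hc.trans_le hx.1
  exact ⟨inv_anti₀ this (hx.2.trans (le_max_left _ _)), inv_anti₀ hc hx.1⟩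

theorem BoundedUniformlyPositive.mul {f g : Space3 → ℝ} (hf : BoundedUniformlyPositive f)
    (hg : BoundedUniformlyPositive g) : BoundedUniformlyPositive fun x => f x * g x := by
  obtain ⟨hm, c, C, hc, h⟩ := hf
  obtain ⟨hm', c', C', hc', h'⟩ := hg
  refine ⟨hm.mul hm', c * c', C * C', by positivity, ?_⟩
  filter_upwards [h, h'] with x hx hx'
  have h1 := hc.trans_le hx.1
  have h2 := hc'.trans_le hx'.1
  exact ⟨mul_le_mul hx.1 hx'.1 hc'.le h1.le, mul_le_mul hx.2 hx'.2 h2.le (h1.le.trans hx.2)⟩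

theorem BoundedUniformlyPositive.one : BoundedUniformlyPositive fun _ => 1 :=
  ⟨aemeasurable_const, 1, 1, one_pos, Eventually.of_forall fun _ => ⟨le_rfl, le_rfl⟩⟩

theorem BoundedUniformlyPositive.ae_pos {f : Space3 → ℝ} (hf : BoundedUniformlyPositive f) :
    ∀ᵐ x, 0 < f x := by
  obtain ⟨-, c, C, hc, h⟩ := hf
  filter_upwards [h] with x hx using hc.trans_le hx.1

/-- A square integrable weak solution `d` of `∇ · (α ∇ d) + z² d = 0` with non-real `z` has
vanishing weak gradient `g`. -/
theorem grad_div_eq_zero {α : Space3 → ℝ} (hα : BoundedUniformlyPositive α) {z : ℂ}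
    (hz : z.im ≠ 0) {d : Space3 → ℂ} (hd : MemLp d 2) {g : Fin 3 → Space3 → ℂ}
    (hg : ∀ i, ScalarL2loc (g i))
    (hgrad : ∀ φ, IsTestFun φ → ∀ i, ∫ x, pderiv3 i φ x • d x = - ∫ x, φ x • g i x)
    (hdiv : ∀ φ, IsTestFun φ →
      ∑ i, ∫ x, pderiv3 i φ x • (α x • g i x) = z ^ 2 * ∫ x, φ x • d x) (i : Fin 3) :
    ∀ᵐ x, g i x = 0 := by
  obtain ⟨C, -, hC⟩ := hα.abs_le
  -- With one unknown and Kronecker coefficients, `D` is the gradient and `D*` is minus the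
  -- divergence.
  have h0 : ∀ᵐ x, d x = 0 :=
    ae_eq_zero_of_weak_system (ι := Fin 3) (κ := Unit)
      (c := fun i j _ => if i = j then 1 else 0) (p := fun _ => d) (g := g) (β := fun _ => 1) hz hα
      BoundedUniformlyPositive.one (fun _ => hd) hg
      (fun φ hφ i => by simpa using hgrad φ hφ i)
      (fun φ hφ _ => by
        rw [show (∫ x, φ x • (z ^ 2 * ((1 : ℝ) • d x))) = z ^ 2 * ∫ x, φ x • d x by
          rw [← integral_const_mul]
          congr 1 with x
          simp only [one_smul, Complex.real_smul]
          ring, ← hdiv φ hφ, ← integral_finsetSum _ fun i _ =>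
            ((hg i).bounded_smul hα.1 hC).integrable_testFun_smul (hφ.pderiv3 i)]
        congr 1 with x
        simp) ()
  refine ae_eq_zero_of_integral_contDiff_smul_eq_zero (hg i).locallyIntegrable
    fun φ hφ hφc => ?_
  have h1 := hgrad φ ⟨hφ, hφc⟩ i
  rw [integral_eq_zero_of_ae (h0.mono fun x hx => by simp [hx])] at h1
  simpa using h1.symm

/-- Square integrable weak solutions of `∇ × (α ∇ × v) = z² β v` with non-real `z` vanish. -/
theorem curl_curl_eq_zero {α β : Space3 → ℝ} (hα : BoundedUniformlyPositive α)
    (hβ : BoundedUniformlyPositive β) {z : ℂ} (hz : z.im ≠ 0) {v W V : Space3 → Vec3}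
    (hv : MemLp v 2) (hW : HasWeakCurl v W) (hV : HasWeakCurl (fun x => α x • W x) V)
    (hVv : ∀ᵐ x, V x = z ^ 2 • β x • v x) (k : Fin 3) : ∀ᵐ x, v x k = 0 := by
  -- The coefficients are the Levi-Civita symbol in cyclic indices; its antisymmetry makes the curl
  -- its own formal adjoint.
  refine ae_eq_zero_of_weak_system (ι := Fin 3) (κ := Fin 3)
    (c := fun i j k => (if j = i + 1 ∧ k = i + 2 then 1 else 0)
      - (if j = i + 2 ∧ k = i + 1 then 1 else 0))
    (p := fun k x => v x k) (g := fun i x => W x i) hz hα hβ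
    (fun k => (EuclideanSpace.proj (𝕜 := ℂ) k).comp_memLp' hv)
    (fun i => hW.2.1.component i) (fun φ hφ i => ?_) (fun φ hφ k => ?_) k
  · rw [← hW.2.2 φ hφ i]
    congr 1 with x
    fin_cases i <;> simp [Fin.sum_univ_three, sub_eq_add_neg]
    ring
  · have h1 := hV.2.2 φ hφ k
    rw [← neg_eq_iff_eq_neg] at h1
    have h2 : ∫ x, φ x • (z ^ 2 * (β x • v x k)) = ∫ x, φ x • V x k := by
      refine integral_congr_ae ?_
      filter_upwards [hVv] with x hx
      rw [hx]
      simp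
    rw [h2, ← h1, ← integral_neg]
    congr 1 with x
    fin_cases k <;> simp [Fin.sum_univ_three, sub_eq_add_neg]
    ring

end Maxwell

/-! ### Absence of non-real eigenvalues. -/

theorem proposition2p5 (ε μ : Space3 → ℝ)
    (hε : BoundedUniformlyPositive ε) (hμ : BoundedUniformlyPositive μ) :
    NoEigenvalues (fun x => ε x * μ x) (MaxwellB ε μ) := by
  rintro z hz u hu ⟨l, w, hl, ⟨C, CC, W, V, hC, hCC, hW, hV, hw⟩, heq⟩
  obtain ⟨d, hd, hdiv⟩ := hu.exists_weak_div
  have hεμ := hε.mul hμ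
  -- The equation solved for `V`; here `l + CC` is the weak gradient of `d`.
  have hVae : ∀ᵐ x, V x = (ε x * μ x)⁻¹ • (l x + CC x) + z ^ 2 • u x := by
    filter_upwards [heq, hw, hεμ.ae_pos] with x h1 h2 h3
    have h4 : (ε x * μ x) • V x = l x + CC x + (ε x * μ x) • z ^ 2 • u x := by
      rw [h2, mul_smul, Complex.coe_smul] at h1
      rw [← sub_eq_zero, ← neg_eq_zero, ← h1]
      abel
    rw [← inv_smul_smul₀ h3.ne' (V x), h4, smul_add, inv_smul_smul₀ h3.ne']
  have hgL : ∀ i, ScalarL2loc fun x => l x i + CC x i := fun i =>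
    (hl.2.1.component i).add (hCC.2.1.component i)
  have hg0 := grad_div_eq_zero hεμ.inv hz hd hgL
    (fun φ hφ i => weak_grad_div hdiv hl hC hCC hφ i) fun φ hφ => by
      have h1 : ∀ i, ∫ x, pderiv3 i φ x • ((ε x * μ x)⁻¹ • (l x i + CC x i))
          = (∫ x, pderiv3 i φ x • V x i) - z ^ 2 * ∫ x, pderiv3 i φ x • u x i := fun i => by
        rw [← integral_const_mul, ← integral_sub
          ((hV.2.1.component i).integrable_testFun_smul (hφ.pderiv3 i))
          (((hl.1.component i).integrable_testFun_smul (hφ.pderiv3 i)).const_mul _)]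
        refine integral_congr_ae ?_
        filter_upwards [hVae] with x hx
        rw [hx]
        simp only [PiLp.add_apply, PiLp.smul_apply, smul_eq_mul, Complex.real_smul]
        ring
      simp_rw [h1]
      -- `V` is divergence free, so only the term `z² div u` survives.
      rw [Finset.sum_sub_distrib, hV.div_eq_zero hφ, ← Finset.mul_sum, hdiv φ hφ]
      ring
  obtain ⟨B, -, hB⟩ := hε.inv.abs_le
  have hv : MemLp (fun x => (ε x)⁻¹ • u x) 2 := by
    refine hu.1.of_le_mul (c := B) (hε.inv.1.aestronglyMeasurable.smul hu.1.1) ?_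
    filter_upwards [hB] with x hx
    rw [norm_smul]
    exact mul_le_mul_of_nonneg_right hx (norm_nonneg _)
  -- With `∇d = 0` the relation for `V` becomes `V = z²u = z²εv`.
  have hvk := curl_curl_eq_zero hμ.inv hε hz hv hW hV (by
    filter_upwards [hVae, hε.ae_pos, hg0 0, hg0 1, hg0 2] with x h1 h2 h3 h4 h5
    have h6 : l x + CC x = 0 := by
      ext i
      fin_cases i
      exacts [h3, h4, h5]
    rw [h1, h6, smul_zero, zero_add, smul_inv_smul₀ h2.ne'])
  filter_upwards [hε.ae_pos, hvk 0, hvk 1, hvk 2] with x h1 h2 h3 h4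
  have h5 : (ε x)⁻¹ • u x = 0 := by
    ext i
    fin_cases i
    exacts [h2, h3, h4]
  exact (smul_eq_zero.1 h5).resolve_left (inv_ne_zero h1.ne')
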